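/- Let $n$ and $m$ be integers with $m>1$ and let $i$ be an integer. Put $\Delta(A_n)=\{1,\dots,n\}$ and let $I_i\subset\Delta(A_n)$ be the subset with complement $\Delta(A_n)\setminus I_i=\{i,i+1,\dots,i+m-3\}$. For $I\subset\Delta(A_n)$, let $A_n/P(I)$ be the flag variety over $\mathbb{C}$, i.e. the quotient of $SL(n+1)$ by the parabolic subgroup $P(I)$ stabilizing the standard flag with members of dimensions $d\in I$; its points are the flags $(V_d)_{d\in I}$ of subspaces of $\mathbb{C}^{n+1}$ with $\dim V_d=d$. If $m$ is odd and $1<i<n-m+3$, then there is a nonconstant morphism $f:\mathbb{P}^m\to A_n/P(I_i)$ of complex varieties. Moreover, $f$ can be chosen as follows. There are a symplectic form $\omega$ on $\mathbb{C}^{m+1}$, a subspace $A\subset\mathbb{C}^{n+1}$ of dimension $i-2$, and an injective linear map $\iota:\mathbb{C}^{m+1}\to\mathbb{C}^{n+1}$ with $A\cap\iota(\mathbb{C}^{m+1})=0$, such that for every line $L\subset\mathbb{C}^{m+1}$ the members of the flag $f(L)$ of dimensions $i-1$ and $i+m-2$ are $A+\iota(L)$ and $A+\iota(L^{\perp})$,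 where $L^\perp$ is the orthogonal of $L$ with respect to $\omega$, while all other members of $f(L)$ are independent of $L$; that is, $f$ takes values in one fibre of the projection $A_n/P(I_i)\to A_n/P(J_i)$, where $\Delta(A_n)\setminus J_i=\{i-1,i,\dots,i+m-2\}$. -/

import Mathlib

open scoped LinearAlgebra.Projectivization Topology

/-- A complex variety in the classical sense, presented as a space with functions: the set of its
(closed) points `X` with the Zariski topology and, for every open `U`, the functions `X → ℂ` whose
restriction to `U` is regular (values outside `U` are irrelevant). -/
structure VarietyStructure (X : Type) where
  zariski : TopologicalSpace X
  IsRegularOn : Set X → (X → ℂ) → Prop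

/-- A morphism of varieties: a Zariski-continuous map that pulls back regular functions on open
sets to regular functions. -/
def IsVarietyMorphism {X Y : Type} (SX : VarietyStructure X) (SY : VarietyStructure Y)
    (f : X → Y) : Prop :=
  (∀ U : Set Y, IsOpen[SY.zariski] U → IsOpen[SX.zariski] (f ⁻¹' U)) ∧
  ∀ (U : Set Y) (φ : Y → ℂ), IsOpen[SY.zariski] U → SY.IsRegularOn U φ →
    SX.IsRegularOn (f ⁻¹' U) (φ ∘ f)

/-- The set of points of the projective space `ℙ^m` over `ℂ`: the lines in `ℂ^(m+1)`. -/
abbrev ProjSpace (m : ℕ) : Type := ℙ ℂ (Fin (m + 1) → ℂ)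

/-- The variety `ℙ^m`. The complements of the zero loci of homogeneous polynomials generate the
topology; a function is regular if it is locally a quotient of two homogeneous polynomials of the
same degree, with nowhere vanishing denominator. -/
def projVariety (m : ℕ) : VarietyStructure (ProjSpace m) :=
  let τ : TopologicalSpace (ProjSpace m) := TopologicalSpace.generateFrom
    {D | ∃ (F : MvPolynomial (Fin (m + 1)) ℂ) (k : ℕ), F.IsHomogeneous k ∧
      D = {x | MvPolynomial.eval x.rep F ≠ 0}}
  { zariski := τ
    IsRegularOn := fun U φ => ∀ p ∈ U, ∃ V : Set (ProjSpace m), IsOpen[τ] V ∧ p ∈ V ∧ V ⊆ U ∧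
      ∃ (F G : MvPolynomial (Fin (m + 1)) ℂ) (k : ℕ), F.IsHomogeneous k ∧ G.IsHomogeneous k ∧
        ∀ x ∈ V, MvPolynomial.eval x.rep G ≠ 0 ∧
          φ x = MvPolynomial.eval x.rep F / MvPolynomial.eval x.rep G }

/-- The group `A_n = SL(n+1)` over `ℂ`. -/
abbrev SLGroup (n : ℕ) : Type := Matrix.SpecialLinearGroup (Fin (n + 1)) ℂ

/-- Value of a polynomial in the matrix entries. -/
noncomputable def evalEntries {n : ℕ} (g : SLGroup n)
    (F : MvPolynomial (Fin (n + 1) × Fin (n + 1)) ℂ) : ℂ :=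
  MvPolynomial.eval (fun p => (g : Matrix (Fin (n + 1)) (Fin (n + 1)) ℂ) p.1 p.2) F

/-- `SL(n+1)` as a closed subvariety of the affine space of matrices. -/
def slVariety (n : ℕ) : VarietyStructure (SLGroup n) :=
  let τ : TopologicalSpace (SLGroup n) := TopologicalSpace.generateFrom
    {D | ∃ F : MvPolynomial (Fin (n + 1) × Fin (n + 1)) ℂ, D = {g | evalEntries g F ≠ 0}}
  { zariski := τ
    IsRegularOn := fun U φ => ∀ p ∈ U, ∃ V : Set (SLGroup n), IsOpen[τ] V ∧ p ∈ V ∧ V ⊆ U ∧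
      ∃ F G : MvPolynomial (Fin (n + 1) × Fin (n + 1)) ℂ,
        ∀ g ∈ V, evalEntries g G ≠ 0 ∧ φ g = evalEntries g F / evalEntries g G }

/-- The standard subspace of `ℂ^(n+1)` spanned by the first `d` basis vectors. -/
def stdSubspace (n d : ℕ) : Submodule ℂ (Fin (n + 1) → ℂ) :=
  Submodule.span ℂ {v | ∃ a : Fin (n + 1), (a : ℕ) < d ∧ v = Pi.single a 1}

/-- The image `g W` of a subspace `W` under `g ∈ SL(n+1)`. -/
noncomputable def slImage {n : ℕ} (g : SLGroup n) (W : Submodule ℂ (Fin (n + 1) → ℂ)) :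
    Submodule ℂ (Fin (n + 1) → ℂ) :=
  W.map (Matrix.toLin' (g : Matrix (Fin (n + 1)) (Fin (n + 1)) ℂ))

theorem slImage_one {n : ℕ} (W : Submodule ℂ (Fin (n + 1) → ℂ)) :
    slImage 1 W = W := by
  simp [slImage, Matrix.toLin'_one]

theorem slImage_mul {n : ℕ} (g h : SLGroup n) (W : Submodule ℂ (Fin (n + 1) → ℂ)) :
    slImage (g * h) W = slImage g (slImage h W) := by
  simp [slImage, Matrix.toLin'_mul, Submodule.map_comp]

/-- The parabolic subgroup `P(I)` of `SL(n+1)`: the stabilizer of the standard flag with members of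
dimensions `d ∈ I`, that is, the block upper triangular matrices with block boundaries in `I`. -/
def parabolic (n : ℕ) (I : Set ℕ) : Subgroup (SLGroup n) where
  carrier := {g | ∀ d ∈ I, slImage g (stdSubspace n d) = stdSubspace n d}
  one_mem' := fun d _ => slImage_one _
  mul_mem' := fun {g h} hg hh d hd => by rw [slImage_mul, hh d hd, hg d hd]
  inv_mem' := fun {g} hg d hd => by
    conv_lhs => rw [← hg d hd]
    rw [← slImage_mul, inv_mul_cancel, slImage_one]

/-- The points of the flag variety `A_n/P(I)`. -/
abbrev FlagVariety (n : ℕ) (I : Set ℕ) : Type := SLGroup n ⧸ parabolic n I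

/-- `A_n/P(I)` as a quotient variety of `SL(n+1)`: it has the quotient topology, and a function is
regular exactly if its pullback to `SL(n+1)` is. -/
def flagVariety (n : ℕ) (I : Set ℕ) : VarietyStructure (FlagVariety n I) where
  zariski := TopologicalSpace.coinduced QuotientGroup.mk (slVariety n).zariski
  IsRegularOn := fun U φ =>
    (slVariety n).IsRegularOn (QuotientGroup.mk ⁻¹' U) (fun g => φ (QuotientGroup.mk g))

/-- The member `V_d`, `d ∈ I`, of the flag in `ℂ^(n+1)` corresponding to a point of `A_n/P(I)`:
the coset of `g` corresponds to the image under `g` of the standard flag. -/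
noncomputable def flagMember {n : ℕ} {I : Set ℕ} (x : FlagVariety n I) (d : I) :
    Submodule ℂ (Fin (n + 1) → ℂ) :=
  Quotient.liftOn' x (fun g => slImage g (stdSubspace n d)) (by
    intro g h hgh
    have hp := (QuotientGroup.leftRel_apply.mp hgh) d d.2
    have hh : h = g * (g⁻¹ * h) := by group
    change slImage g _ = slImage h _
    rw [hh, slImage_mul, hp])

/-- The subset `I_i` of `Δ(A_n) = {1, …, n}` with complement `{i, i+1, …, i+m-3}`. -/
def indexSet (n m i : ℕ) : Set ℕ := Set.Icc 1 n \ Set.Icc i (i + m - 3)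

/-! The symplectic group of `ω` acts transitively on lines, and an isometry carrying `L₀` to `L`
carries `L₀^⊥` to `L^⊥`. With `k = i - 2`, let `h` be symplectic with first standard line sent to
`L`, and let `f L` be the coset of the block matrix `diag(1_k, h, 1)`. This matrix can move only the
standard subspaces of dimensions `k + 1, …, k + m`; of these `I_i` retains only the two ends, whose
images depend on `L` alone. The form exists because `m + 1` is even; it is chosen so that the
standard hyperplane is the orthogonal of the first standard line (`stdSubspace_eq_orthogonal`).

For regularity, `h` is chosen algebraically near each point (`exists_chart_formStabilizer`): where
`ω(x, z) ≠ 0`, one transvection sends a fixed `z` to `x / ω(x, z)`. Different choices give the same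
coset, since a coset is determined by its flag, so `isVarietyMorphism_of_local_lift` applies. -/

/-! ### Charts of projective space and a criterion for morphisms -/

/-- The functions on `ℙ^m` which, where the form `ℓ` does not vanish, are quotients of a
homogeneous polynomial by a power of `ℓ` of the same degree. -/
def chartAlgebra {m : ℕ} (ℓ : MvPolynomial (Fin (m + 1)) ℂ) (hℓ : ℓ.IsHomogeneous 1) :
    Subalgebra ℂ (ProjSpace m → ℂ) where
  carrier := {φ | ∃ (H : MvPolynomial (Fin (m + 1)) ℂ) (N : ℕ), H.IsHomogeneous N ∧
    ∀ x : ProjSpace m, MvPolynomial.eval x.rep ℓ ≠ 0 →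
      φ x = MvPolynomial.eval x.rep H / MvPolynomial.eval x.rep ℓ ^ N}
  mul_mem' := by
    rintro φ ψ ⟨H, N, hH, h⟩ ⟨K, M, hK, k⟩
    refine ⟨H * K, N + M, hH.mul hK, fun x hx => ?_⟩
    rw [Pi.mul_apply, h x hx, k x hx, map_mul, pow_add, div_mul_div_comm]
  add_mem' := by
    rintro φ ψ ⟨H, N, hH, h⟩ ⟨K, M, hK, k⟩
    have hp (j : ℕ) : (ℓ ^ j).IsHomogeneous j := by simpa using hℓ.pow j
    refine ⟨H * ℓ ^ M + ℓ ^ N * K, N + M, (hH.mul (hp M)).add ((hp N).mul hK), fun x hx => ?_⟩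
    rw [Pi.add_apply, h x hx, k x hx, div_add_div _ _ (pow_ne_zero _ hx) (pow_ne_zero _ hx)]
    simp [pow_add]
  algebraMap_mem' := fun c =>
    ⟨MvPolynomial.C c, 0, MvPolynomial.isHomogeneous_C _ c, fun x _ => by simp⟩

theorem isOpen_eval_ne_zero {m k : ℕ} {F : MvPolynomial (Fin (m + 1)) ℂ}
    (hF : F.IsHomogeneous k) :
    IsOpen[(projVariety m).zariski] {x : ProjSpace m | MvPolynomial.eval x.rep F ≠ 0} :=
  TopologicalSpace.isOpen_generateFrom_of_mem ⟨F, k, hF, rfl⟩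

theorem evalEntries_mem_chartAlgebra {m n : ℕ} {ℓ : MvPolynomial (Fin (m + 1)) ℂ}
    {hℓ : ℓ.IsHomogeneous 1} {s : ProjSpace m → SLGroup n}
    (hs : ∀ a b, (fun x => (s x).1 a b) ∈ chartAlgebra ℓ hℓ)
    (F : MvPolynomial (Fin (n + 1) × Fin (n + 1)) ℂ) :
    (fun x => evalEntries (s x) F) ∈ chartAlgebra ℓ hℓ := by
  induction F using MvPolynomial.induction_on with
  | C c =>
    simp only [evalEntries, MvPolynomial.eval_C]
    exact (chartAlgebra ℓ hℓ).algebraMap_mem c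
  | add F G hF hG =>
    simp only [evalEntries, map_add]
    exact (chartAlgebra ℓ hℓ).add_mem hF hG
  | mul_X F p hF =>
    simp only [evalEntries, map_mul, MvPolynomial.eval_X]
    exact (chartAlgebra ℓ hℓ).mul_mem hF (hs p.1 p.2)

/-- On the chart a polynomial in the entries of `s` is `H / ℓ ^ N`, so it is nonzero exactly where
the form `H` is. -/
theorem isOpen_preimage_inter_chart {m n : ℕ} {ℓ : MvPolynomial (Fin (m + 1)) ℂ}
    {hℓ : ℓ.IsHomogeneous 1} {s : ProjSpace m → SLGroup n}
    (hs : ∀ a b, (fun x => (s x).1 a b) ∈ chartAlgebra ℓ hℓ) {U : Set (SLGroup n)}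
    (hU : IsOpen[(slVariety n).zariski] U) :
    IsOpen[(projVariety m).zariski] (s ⁻¹' U ∩ {x | MvPolynomial.eval x.rep ℓ ≠ 0}) := by
  let _ := (projVariety m).zariski
  induction hU with
  | basic U hU =>
    obtain ⟨F, rfl⟩ := hU
    obtain ⟨H, N, hH, h⟩ := evalEntries_mem_chartAlgebra hs F
    convert (isOpen_eval_ne_zero hH).inter (isOpen_eval_ne_zero hℓ) using 1
    ext x
    refine and_congr_left fun hx => ?_
    change evalEntries (s x) F ≠ 0 ↔ _
    rw [show evalEntries (s x) F = _ from h x hx]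
    simp [show MvPolynomial.eval x.rep ℓ ≠ 0 from hx]
  | univ => simpa using isOpen_eval_ne_zero hℓ
  | inter U V _ _ hU hV =>
    rw [Set.preimage_inter, Set.inter_inter_distrib_right]
    exact hU.inter hV
  | sUnion S _ hS =>
    rw [Set.preimage_sUnion, Set.iUnion₂_inter]
    exact isOpen_biUnion hS

/-- A map to a flag variety which on the members of a cover by charts lifts to `SL(n+1)` with
entries in the chart algebras is a morphism. -/
theorem isVarietyMorphism_of_local_lift {m n : ℕ} {I : Set ℕ} (f : ProjSpace m → FlagVariety n I)
    (h : ∀ p : ProjSpace m, ∃ (ℓ : MvPolynomial (Fin (m + 1)) ℂ) (hℓ : ℓ.IsHomogeneous 1)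
      (s : ProjSpace m → SLGroup n), MvPolynomial.eval p.rep ℓ ≠ 0 ∧
      (∀ a b, (fun x => (s x).1 a b) ∈ chartAlgebra ℓ hℓ) ∧
      ∀ x : ProjSpace m, MvPolynomial.eval x.rep ℓ ≠ 0 → f x = QuotientGroup.mk (s x)) :
    IsVarietyMorphism (projVariety m) (flagVariety n I) f := by
  let _ := (projVariety m).zariski
  have hopen (U : Set (FlagVariety n I)) (hU : IsOpen[(flagVariety n I).zariski] U) :
      IsOpen (f ⁻¹' U) := by
    refine isOpen_iff_forall_mem_open.2 fun p hp => ?_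
    obtain ⟨ℓ, hℓ, s, hpℓ, hs, hfs⟩ := h p
    refine ⟨_, ?_, isOpen_preimage_inter_chart hs (U := QuotientGroup.mk ⁻¹' U) hU, ?_, hpℓ⟩
    · rintro x ⟨hx, hxℓ⟩
      rw [Set.mem_preimage, hfs x hxℓ]
      exact hx
    · rw [Set.mem_preimage, hfs p hpℓ] at hp
      exact hp
  refine ⟨hopen, fun U φ hU hφ p hp => ?_⟩
  obtain ⟨ℓ, hℓ, s, hpℓ, hs, hfs⟩ := h p
  have hp' : s p ∈ (QuotientGroup.mk ⁻¹' U : Set (SLGroup n)) := by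
    rw [Set.mem_preimage, hfs p hpℓ] at hp
    exact hp
  obtain ⟨V, hV, hpV, hVU, F, G, hFG⟩ := hφ (s p) hp'
  obtain ⟨H, N, hH, hF⟩ := evalEntries_mem_chartAlgebra hs F
  obtain ⟨K, M, hK, hG⟩ := evalEntries_mem_chartAlgebra hs G
  have hpow (j : ℕ) : (ℓ ^ j).IsHomogeneous j := by simpa using hℓ.pow j
  -- The quotient of `H / ℓ ^ N` by `K / ℓ ^ M`, cleared of denominators; both forms have degree `N
  -- + M`.
  refine ⟨_, isOpen_preimage_inter_chart hs hV, ⟨hpV, hpℓ⟩, ?_, H * ℓ ^ M, ℓ ^ N * K, N + M,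
    hH.mul (hpow M), (hpow N).mul hK, ?_⟩
  · rintro x ⟨hx, hxℓ⟩
    rw [Set.mem_preimage, hfs x hxℓ]
    exact hVU hx
  · rintro x ⟨hx, hxℓ⟩
    obtain ⟨hG0, hφx⟩ := hFG (s x) hx
    dsimp only at hφx hF hG
    rw [hF x hxℓ, hG x hxℓ] at hφx
    rw [hG x hxℓ] at hG0
    have hK0 : MvPolynomial.eval x.rep K ≠ 0 := fun h0 => hG0 (by rw [h0, zero_div])
    have hℓ0 : MvPolynomial.eval x.rep ℓ ≠ 0 := hxℓ
    refine ⟨by simp [hK0, hℓ0], ?_⟩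
    rw [Function.comp_apply, hfs x hxℓ, hφx, map_mul, map_mul, map_pow, map_pow,
      div_div_div_eq]

/-! ### Standard subspaces and cosets -/

theorem mem_stdSubspace {n d : ℕ} {v : Fin (n + 1) → ℂ} :
    v ∈ stdSubspace n d ↔ ∀ a : Fin (n + 1), d ≤ a → v a = 0 := by
  constructor
  · intro hv a ha
    induction hv using Submodule.span_induction with
    | mem v hv =>
      obtain ⟨b, hb, rfl⟩ := hv
      exact Pi.single_eq_of_ne (fun h => by subst h; omega) _
    | zero => rfl
    | add v w _ _ hv hw => simp [hv, hw]
    | smul c v _ hv => simp [hv]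
  · intro hv
    rw [pi_eq_sum_univ' v]
    refine Submodule.sum_mem _ fun a _ => ?_
    by_cases ha : d ≤ a
    · simp [hv a ha]
    · refine Submodule.smul_mem _ _ (Submodule.subset_span ⟨a, not_le.1 ha, ?_⟩)
      ext b
      simp [Pi.single_apply, eq_comm]

theorem mk_eq_mk_of_slImage_eq {n : ℕ} {I : Set ℕ} {g h : SLGroup n}
    (hgh : ∀ d ∈ I, slImage g (stdSubspace n d) = slImage h (stdSubspace n d)) :
    (QuotientGroup.mk g : FlagVariety n I) = QuotientGroup.mk h := by
  refine QuotientGroup.eq.2 fun d hd => ?_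
  rw [slImage_mul, ← hgh d hd, ← slImage_mul, inv_mul_cancel, slImage_one]

theorem slImage_eq_of_le {n : ℕ} {g : SLGroup n} {W : Submodule ℂ (Fin (n + 1) → ℂ)}
    (h : slImage g W ≤ W) : slImage g W = W := by
  have hinj : Function.Injective (Matrix.toLin' (g : Matrix (Fin (n + 1)) (Fin (n + 1)) ℂ)) :=
    Matrix.mulVec_injective_of_isUnit
      ((Matrix.isUnit_iff_isUnit_det _).2 (by rw [g.det_coe]; exact isUnit_one))
  exact Submodule.eq_of_le_of_finrank_eq h (Submodule.equivMapOfInjective _ hinj W).finrank_eq.symm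

theorem slImage_span_singleton {n : ℕ} (g : SLGroup n) (v : Fin (n + 1) → ℂ) :
    slImage g (ℂ ∙ v) = ℂ ∙ Matrix.toLin' g.1 v := by
  simp [slImage, Submodule.map_span]

theorem toLin'_mul_apply {n : ℕ} (g h : SLGroup n) (v : Fin (n + 1) → ℂ) :
    Matrix.toLin' (g * h).1 v = Matrix.toLin' g.1 (Matrix.toLin' h.1 v) := by
  simp [Matrix.mulVec_mulVec]

/-! ### Symplectic group and transvections -/

/-- The symplectic group of a bilinear form, inside the special linear group. -/
def formStabilizer {m : ℕ} (ω : LinearMap.BilinForm ℂ (Fin (m + 1) → ℂ)) :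
    Subgroup (SLGroup m) where
  carrier := {g | ∀ x y, ω (Matrix.toLin' g.1 x) (Matrix.toLin' g.1 y) = ω x y}
  one_mem' := fun x y => by simp
  mul_mem' := fun {g h} hg hh x y => by rw [toLin'_mul_apply, toLin'_mul_apply, hg, hh]
  inv_mem' := fun {g} hg x y => by
    rw [← hg, ← toLin'_mul_apply, ← toLin'_mul_apply, mul_inv_cancel]
    simp

/-- An isometry preserves orthogonality, which gives one inclusion; the same inclusion for `g⁻¹`
gives the other. -/
theorem slImage_orthogonal {m : ℕ} {ω : LinearMap.BilinForm ℂ (Fin (m + 1) → ℂ)} {g : SLGroup m}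
    (hg : g ∈ formStabilizer ω) (W : Submodule ℂ (Fin (m + 1) → ℂ)) :
    slImage g (ω.orthogonal W) = ω.orthogonal (slImage g W) := by
  have hle (g : SLGroup m) (hg : g ∈ formStabilizer ω) (W : Submodule ℂ (Fin (m + 1) → ℂ)) :
      slImage g (ω.orthogonal W) ≤ ω.orthogonal (slImage g W) := by
    rintro _ ⟨v, hv, rfl⟩ _ ⟨w, hw, rfl⟩
    exact (hg w v).trans (hv w hw)
  refine le_antisymm (hle g hg W) ?_
  have h := Submodule.map_mono (f := Matrix.toLin' g.1) (hle g⁻¹ (inv_mem hg) (slImage g W))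
  change slImage g (slImage g⁻¹ _) ≤ slImage g _ at h
  rwa [← slImage_mul, ← slImage_mul, mul_inv_cancel, inv_mul_cancel, slImage_one,
    slImage_one] at h

/-- The transvection `v ↦ v + a ω(d, v) d` for an alternating form `ω`. -/
noncomputable def formTransvection {m : ℕ} (ω : LinearMap.BilinForm ℂ (Fin (m + 1) → ℂ))
    (hω : ω.IsAlt) (a : ℂ) (d : Fin (m + 1) → ℂ) : SLGroup m :=
  ⟨LinearMap.toMatrix' (LinearMap.transvection (a • ω d) d), by
    rw [LinearMap.det_toMatrix', LinearMap.transvection.det, LinearMap.smul_apply, hω d, smul_zero,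
      add_zero]⟩

section Transvection

variable {m : ℕ} {ω : LinearMap.BilinForm ℂ (Fin (m + 1) → ℂ)} (hω : ω.IsAlt)
include hω

theorem toLin'_formTransvection (a : ℂ) (d v : Fin (m + 1) → ℂ) :
    Matrix.toLin' (formTransvection ω hω a d).1 v = v + (a * ω d v) • d := by
  rw [formTransvection, Matrix.toLin'_toMatrix']
  rfl

theorem formTransvection_mem (a : ℂ) (d : Fin (m + 1) → ℂ) :
    formTransvection ω hω a d ∈ formStabilizer ω := fun x y => by
  simp only [toLin'_formTransvection, map_add, map_smul, LinearMap.add_apply,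
    LinearMap.smul_apply, smul_eq_mul, hω d, ← hω.neg_eq d x]
  ring

/-- Since `ω(u, u) = 0`, the coefficient `a ω(v - u, u)` of `v - u` is 1. -/
theorem toLin'_formTransvection_sub {a : ℂ} {u v : Fin (m + 1) → ℂ} (h : a * ω v u = 1) :
    Matrix.toLin' (formTransvection ω hω a (v - u)).1 u = v := by
  rw [toLin'_formTransvection, map_sub, LinearMap.sub_apply, hω u, sub_zero, h, one_smul,
    add_sub_cancel]

/-- One transvection moves `u` to `v` only if `ω(v, u) ≠ 0`; in general two suffice, through some
`w` orthogonal to neither. -/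
theorem exists_mem_formStabilizer_toLin'_eq (hnd : ω.Nondegenerate) {u v : Fin (m + 1) → ℂ}
    (hu : u ≠ 0) (hv : v ≠ 0) : ∃ g ∈ formStabilizer ω, Matrix.toLin' g.1 u = v := by
  have hex (u : Fin (m + 1) → ℂ) (hu : u ≠ 0) : ∃ w, ω w u ≠ 0 := by
    by_contra! h
    exact hu (hnd.2 u h)
  obtain ⟨w, hwu, hwv⟩ : ∃ w, ω w u ≠ 0 ∧ ω w v ≠ 0 := by
    obtain ⟨w₁, h₁⟩ := hex u hu
    obtain ⟨w₂, h₂⟩ := hex v hv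
    by_cases h₃ : ω w₁ v = 0
    · by_cases h₄ : ω w₂ u = 0
      · exact ⟨w₁ + w₂, by simpa [h₄] using h₁, by simpa [h₃] using h₂⟩
      · exact ⟨w₂, h₄, h₂⟩
    · exact ⟨w₁, h₁, h₃⟩
  have hvw : ω v w ≠ 0 := by rwa [← hω.neg_eq, neg_ne_zero]
  refine ⟨_, mul_mem (formTransvection_mem hω (ω v w)⁻¹ (v - w))
    (formTransvection_mem hω (ω w u)⁻¹ (w - u)), ?_⟩
  rw [toLin'_mul_apply, toLin'_formTransvection_sub hω (inv_mul_cancel₀ hwu),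
    toLin'_formTransvection_sub hω (inv_mul_cancel₀ hvw)]

end Transvection

/-! ### Block inclusion of `SL(m+1)` in `SL(n+1)` -/

/-- The matrix of the inclusion `ℂ^(m+1) → ℂ^(n+1)` which shifts the standard basis by `k`. -/
def shiftMatrix (n m k : ℕ) : Matrix (Fin (n + 1)) (Fin (m + 1)) ℂ :=
  Matrix.of fun a b => if (a : ℕ) = b + k then 1 else 0

section Shift

variable {n m k : ℕ} (hk : k + m ≤ n)
include hk

theorem transpose_shiftMatrix_mulVec (w : Fin (n + 1) → ℂ) (b : Fin (m + 1)) :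
    ((shiftMatrix n m k).transpose.mulVec w) b = w ⟨b + k, by omega⟩ := by
  rw [Matrix.mulVec, dotProduct, Finset.sum_eq_single ⟨b + k, by omega⟩]
  · simp [shiftMatrix]
  · intro a _ ha
    have ha' : (a : ℕ) ≠ b + k := fun h => ha (Fin.ext h)
    simp [shiftMatrix, ha']
  · exact fun h => absurd (Finset.mem_univ _) h

theorem transpose_shiftMatrix_mul_shiftMatrix :
    (shiftMatrix n m k).transpose * shiftMatrix n m k = 1 := by
  refine Matrix.ext_of_mulVec_single fun c => ?_
  ext b
  rw [← Matrix.mulVec_mulVec, transpose_shiftMatrix_mulVec hk, Matrix.mulVec_single_one]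
  simp [shiftMatrix, Matrix.one_apply, Fin.ext_iff]

theorem transpose_shiftMatrix_mulVec_shiftMatrix (v : Fin (m + 1) → ℂ) :
    (shiftMatrix n m k).transpose.mulVec ((shiftMatrix n m k).mulVec v) = v := by
  rw [Matrix.mulVec_mulVec, transpose_shiftMatrix_mul_shiftMatrix hk, Matrix.one_mulVec]

theorem shiftMatrix_mulVec_apply_add (v : Fin (m + 1) → ℂ) (b : Fin (m + 1)) :
    (shiftMatrix n m k).mulVec v ⟨b + k, by omega⟩ = v b := by
  have h := transpose_shiftMatrix_mulVec hk ((shiftMatrix n m k).mulVec v) b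
  rwa [transpose_shiftMatrix_mulVec_shiftMatrix hk, eq_comm] at h

omit hk in
theorem shiftMatrix_mulVec_eq_zero (v : Fin (m + 1) → ℂ) {a : Fin (n + 1)}
    (ha : ∀ b : Fin (m + 1), (a : ℕ) ≠ b + k) : (shiftMatrix n m k).mulVec v a = 0 := by
  simp [Matrix.mulVec, dotProduct, shiftMatrix, ha]

/-- The block diagonal inclusion `SL(m+1) → SL(n+1)` with the block starting after `k` ones. -/
def blockInclusion {n m k : ℕ} (hk : k + m ≤ n) (h : SLGroup m) : SLGroup n :=
  ⟨1 + shiftMatrix n m k * ((h.1 - 1) * (shiftMatrix n m k).transpose), by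
    -- Sylvester's identity `det (1 + S B) = det (1 + B S)` together with `Sᵀ S = 1` reduces the
    -- determinant to `det h`.
    rw [Matrix.det_one_add_mul_comm, Matrix.mul_assoc, transpose_shiftMatrix_mul_shiftMatrix hk,
      Matrix.mul_one,
      add_sub_cancel, h.2]⟩

theorem blockInclusion_mulVec (h : SLGroup m) (w : Fin (n + 1) → ℂ) :
    (blockInclusion hk h).1.mulVec w = w + (shiftMatrix n m k).mulVec
      ((h.1 - 1).mulVec ((shiftMatrix n m k).transpose.mulVec w)) := by
  simp [blockInclusion, Matrix.add_mulVec, Matrix.mulVec_mulVec]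

theorem blockInclusion_mulVec_shiftMatrix (h : SLGroup m) (v : Fin (m + 1) → ℂ) :
    (blockInclusion hk h).1.mulVec ((shiftMatrix n m k).mulVec v) =
      (shiftMatrix n m k).mulVec (h.1.mulVec v) := by
  rw [blockInclusion_mulVec, transpose_shiftMatrix_mulVec_shiftMatrix hk, ← Matrix.mulVec_add,
    Matrix.sub_mulVec, Matrix.one_mulVec, add_sub_cancel]

theorem transpose_shiftMatrix_mulVec_of_mem {d : ℕ} (hd : d ≤ k) {w : Fin (n + 1) → ℂ}
    (hw : w ∈ stdSubspace n d) : (shiftMatrix n m k).transpose.mulVec w = 0 := by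
  ext b
  rw [transpose_shiftMatrix_mulVec hk]
  exact mem_stdSubspace.1 hw _ (by dsimp only; omega)

theorem slImage_blockInclusion_of_le (h : SLGroup m) {d : ℕ} (hd : d ≤ k) :
    slImage (blockInclusion hk h) (stdSubspace n d) = stdSubspace n d := by
  refine slImage_eq_of_le ?_
  rintro _ ⟨w, hw, rfl⟩
  rw [Matrix.toLin'_apply, blockInclusion_mulVec, transpose_shiftMatrix_mulVec_of_mem hk hd hw]
  simpa using hw

/-- The block alters a vector only by elements of the range of the shift, which lies in this
subspace. -/
theorem slImage_blockInclusion_of_lt (h : SLGroup m) {d : ℕ} (hd : k + m < d) :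
    slImage (blockInclusion hk h) (stdSubspace n d) = stdSubspace n d := by
  refine slImage_eq_of_le ?_
  rintro _ ⟨w, hw, rfl⟩
  rw [Matrix.toLin'_apply, blockInclusion_mulVec]
  refine add_mem hw (mem_stdSubspace.2 fun a ha => shiftMatrix_mulVec_eq_zero _ fun b => ?_)
  omega

theorem stdSubspace_add {e : ℕ} (he : e ≤ m + 1) :
    stdSubspace n (k + e) =
      stdSubspace n k ⊔ (stdSubspace m e).map (Matrix.toLin' (shiftMatrix n m k)) := by
  refine le_antisymm (fun w hw => ?_) (sup_le (fun w hw => ?_) ?_)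
  · rw [mem_stdSubspace] at hw
    rw [← sub_add_cancel w
      ((shiftMatrix n m k).mulVec ((shiftMatrix n m k).transpose.mulVec w))]
    refine Submodule.add_mem_sup (mem_stdSubspace.2 fun a ha => ?_)
      ⟨_, mem_stdSubspace.2 fun b hb => ?_, rfl⟩
    · by_cases hak : (a : ℕ) ≤ k + m
      · obtain ⟨b, hb⟩ : ∃ b : Fin (m + 1), a = ⟨b + k, by omega⟩ :=
          ⟨⟨a - k, by omega⟩, Fin.ext (by dsimp only; omega)⟩
        rw [hb, Pi.sub_apply, shiftMatrix_mulVec_apply_add hk, transpose_shiftMatrix_mulVec hk,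
          sub_self]
      · rw [Pi.sub_apply, hw a (by omega), shiftMatrix_mulVec_eq_zero _ fun b => by omega,
          sub_zero]
    · rw [transpose_shiftMatrix_mulVec hk]
      exact hw _ (by dsimp only; omega)
  · rw [mem_stdSubspace] at hw ⊢
    exact fun a ha => hw a (by omega)
  · rintro _ ⟨v, hv, rfl⟩
    refine mem_stdSubspace.2 fun a ha => ?_
    rw [Matrix.toLin'_apply]
    by_cases hak : (a : ℕ) ≤ k + m
    · obtain ⟨b, hb⟩ : ∃ b : Fin (m + 1), a = ⟨b + k, by omega⟩ :=
        ⟨⟨a - k, by omega⟩, Fin.ext (by dsimp only; omega)⟩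
      rw [hb, shiftMatrix_mulVec_apply_add hk]
      exact mem_stdSubspace.1 hv b (by rw [hb] at ha; dsimp only at ha; omega)
    · exact shiftMatrix_mulVec_eq_zero _ fun b => by omega

theorem slImage_blockInclusion_add (h : SLGroup m) {e : ℕ} (he : e ≤ m + 1) :
    slImage (blockInclusion hk h) (stdSubspace n (k + e)) = stdSubspace n k ⊔
      (slImage h (stdSubspace m e)).map (Matrix.toLin' (shiftMatrix n m k)) := by
  rw [stdSubspace_add hk he, slImage, Submodule.map_sup]
  congr 1
  · exact slImage_blockInclusion_of_le hk h le_rfl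
  · rw [slImage, ← Submodule.map_comp, ← Submodule.map_comp]
    congr 1
    exact LinearMap.ext fun v => blockInclusion_mulVec_shiftMatrix hk h v

theorem disjoint_stdSubspace_range_shiftMatrix :
    Disjoint (stdSubspace n k) (LinearMap.range (Matrix.toLin' (shiftMatrix n m k))) := by
  rw [Submodule.disjoint_def]
  rintro _ hv ⟨v, rfl⟩
  have h := transpose_shiftMatrix_mulVec_of_mem hk le_rfl hv
  rw [Matrix.toLin'_apply, transpose_shiftMatrix_mulVec_shiftMatrix hk] at h
  rw [h, map_zero]

/-- The transpose kills the first `k` basis vectors and inverts the shift. This recovers `L` from `f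
L`, whence `f` is not constant. -/
theorem map_transpose_shiftMatrix_sup (W : Submodule ℂ (Fin (m + 1) → ℂ)) :
    (stdSubspace n k ⊔ W.map (Matrix.toLin' (shiftMatrix n m k))).map
      (Matrix.toLin' (shiftMatrix n m k).transpose) = W := by
  have h₁ : (stdSubspace n k).map (Matrix.toLin' (shiftMatrix n m k).transpose) = ⊥ :=
    (Submodule.eq_bot_iff _).2 (by
      rintro _ ⟨v, hv, rfl⟩
      exact transpose_shiftMatrix_mulVec_of_mem hk le_rfl hv)
  rw [Submodule.map_sup, h₁, bot_sup_eq, ← Submodule.map_comp, ← Matrix.toLin'_mul,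
    transpose_shiftMatrix_mul_shiftMatrix hk, Matrix.toLin'_one, Submodule.map_id]

end Shift

/-! ### Dimensions and the antidiagonal symplectic form -/

theorem finrank_stdSubspace {n d : ℕ} (hd : d ≤ n + 1) :
    Module.finrank ℂ (stdSubspace n d) = d := by
  have h : {v : Fin (n + 1) → ℂ | ∃ a : Fin (n + 1), (a : ℕ) < d ∧ v = Pi.single a 1} =
      Set.range (Pi.basisFun ℂ (Fin (n + 1)) ∘ Fin.castLE hd) := by
    ext v
    simp only [Set.mem_ofPred_eq, Set.mem_range, Function.comp_apply, Pi.basisFun_apply]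
    exact ⟨fun ⟨a, ha, hv⟩ => ⟨⟨a, ha⟩, hv.symm⟩, fun ⟨a, ha⟩ => ⟨_, a.2, ha.symm⟩⟩
  rw [stdSubspace, h, finrank_span_eq_card ((Pi.basisFun ℂ (Fin (n + 1))).linearIndependent.comp _
    (Fin.castLE_injective hd)), Fintype.card_fin]

theorem stdSubspace_one (m : ℕ) : stdSubspace m 1 = ℂ ∙ (Pi.single 0 1 : Fin (m + 1) → ℂ) := by
  rw [stdSubspace]
  congr 1
  ext v
  refine ⟨fun ⟨a, ha, hv⟩ => ?_, fun hv => ⟨0, Nat.zero_lt_one, hv⟩⟩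
  obtain rfl : a = 0 := Fin.ext (by rw [Fin.val_zero]; omega)
  exact hv

/-- The antidiagonal matrix with entries `1` above and `-1` below the diagonal. -/
def antidiagMatrix (m : ℕ) : Matrix (Fin (m + 1)) (Fin (m + 1)) ℂ :=
  Matrix.of fun a b => if b = a.rev then (if a < b then 1 else -1) else 0

theorem antidiagMatrix_mulVec {m : ℕ} (v : Fin (m + 1) → ℂ) (a : Fin (m + 1)) :
    (antidiagMatrix m).mulVec v a = (if a < a.rev then 1 else -1) * v a.rev := by
  simp [Matrix.mulVec, dotProduct, antidiagMatrix]

/-- For odd `m` the reversal of the `m + 1` indices has no fixed point. -/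
theorem lt_rev_iff_not_rev_lt {m : ℕ} (hm : Odd m) (a : Fin (m + 1)) :
    a < a.rev ↔ ¬ a.rev < a := by
  obtain ⟨r, rfl⟩ := hm
  simp only [Fin.lt_def, Fin.val_rev]
  omega

theorem isAlt_antidiagMatrix {m : ℕ} (hm : Odd m) : (antidiagMatrix m).toBilin'.IsAlt := by
  intro v
  rw [Matrix.toBilin'_apply', dotProduct]
  -- Reindexing the sum by reversal changes the sign of every term.
  refine self_eq_neg.1 ?_
  rw [← Finset.sum_neg_distrib, ← Equiv.sum_comp Fin.revPerm]
  refine Finset.sum_congr rfl fun a _ => ?_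
  have h := lt_rev_iff_not_rev_lt hm a
  by_cases h' : a.rev < a <;> simp [antidiagMatrix_mulVec, h, h', mul_comm]

theorem nondegenerate_antidiagMatrix (m : ℕ) : (antidiagMatrix m).toBilin'.Nondegenerate := by
  rw [LinearMap.BilinForm.nondegenerate_toBilin'_iff_det_ne_zero, ← isUnit_iff_ne_zero,
    ← Matrix.isUnit_iff_isUnit_det, ← Matrix.mulVec_injective_iff_isUnit,
    ← Matrix.coe_mulVecLin, injective_iff_map_eq_zero]
  intro v hv
  ext a
  have h := congrFun hv a.rev
  rw [Matrix.mulVecLin_apply, antidiagMatrix_mulVec, Fin.rev_rev] at h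
  split_ifs at h <;> simpa using h

/-- Pairing with the first basis vector reads off the last coordinate. -/
theorem stdSubspace_eq_orthogonal {m : ℕ} (hm : Odd m) :
    stdSubspace m m = (antidiagMatrix m).toBilin'.orthogonal (stdSubspace m 1) := by
  ext v
  rw [stdSubspace_one, LinearMap.BilinForm.mem_orthogonal_iff, mem_stdSubspace]
  have h₀ : (antidiagMatrix m).toBilin' (Pi.single 0 1) v = v (Fin.last m) := by
    have : (0 : Fin (m + 1)) < Fin.last m := Fin.pos_iff_ne_zero.2 (by
      simpa [Fin.ext_iff] using hm.pos.ne')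
    simp [Matrix.toBilin'_apply', antidiagMatrix_mulVec, this]
  constructor
  · intro h w hw
    obtain ⟨c, rfl⟩ := Submodule.mem_span_singleton.1 hw
    rw [map_smul, LinearMap.smul_apply, h₀, h _ le_rfl,
      smul_zero]
  · intro h a ha
    obtain rfl : a = Fin.last m := Fin.ext (by rw [Fin.val_last]; omega)
    rw [← h₀]
    exact h _ (Submodule.mem_span_singleton_self _)

/-! ### Algebraic local lifts -/

theorem mul_mem_chartAlgebra {m : ℕ} {ι κ τ : Type} [Fintype κ]
    {R : Subalgebra ℂ (ProjSpace m → ℂ)} {M : ProjSpace m → Matrix ι κ ℂ}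
    {N : ProjSpace m → Matrix κ τ ℂ} (hM : ∀ a b, (fun x => M x a b) ∈ R)
    (hN : ∀ a b, (fun x => N x a b) ∈ R) (a : ι) (b : τ) : (fun x => (M x * N x) a b) ∈ R := by
  have h : (fun x => (M x * N x) a b) =
      ∑ c, (fun x => M x a c) * (fun x => N x c b) := by
    ext x
    simp [Matrix.mul_apply]
  rw [h]
  exact R.sum_mem fun c _ => R.mul_mem (hM a c) (hN c b)

/-- The entries `δ_ab + t ω(d, e_b) d_a` are polynomials in the coordinates of `d`. -/
theorem formTransvection_mem_chartAlgebra {m : ℕ} {R : Subalgebra ℂ (ProjSpace m → ℂ)}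
    {ω : LinearMap.BilinForm ℂ (Fin (m + 1) → ℂ)} (hω : ω.IsAlt) (t : ℂ)
    {d : ProjSpace m → Fin (m + 1) → ℂ} (hd : ∀ a, (fun x => d x a) ∈ R) (a b : Fin (m + 1)) :
    (fun x => (formTransvection ω hω t (d x)).1 a b) ∈ R := by
  have h : (fun x => (formTransvection ω hω t (d x)).1 a b) =
      (fun _ => (1 : Matrix (Fin (m + 1)) (Fin (m + 1)) ℂ) a b) +
      (t • ∑ c, ω (Pi.single c 1) (Pi.single b 1) • fun x => d x c) * fun x => d x a := by
    ext x
    have hx : ω (d x) (Pi.single b 1) = ∑ c, ω (Pi.single c 1) (Pi.single b 1) * d x c := by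
      conv_lhs => rw [pi_eq_sum_univ' (d x)]
      simp only [map_sum, LinearMap.sum_apply, map_smul, LinearMap.smul_apply, smul_eq_mul]
      refine Finset.sum_congr rfl fun c _ => ?_
      rw [mul_comm]
    have hv := congrFun (toLin'_formTransvection hω t (d x) (Pi.single b 1)) a
    rw [Matrix.toLin'_apply, Matrix.mulVec_single_one] at hv
    refine hv.trans ?_
    simp [hx, Matrix.one_apply, Pi.single_apply, mul_assoc]
  rw [h]
  exact R.add_mem (R.algebraMap_mem _)
    (R.mul_mem (R.smul_mem (R.sum_mem fun c _ => R.smul_mem (hd c) _) _) (hd a))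

theorem blockInclusion_mem_chartAlgebra {n m k : ℕ} (hk : k + m ≤ n)
    {R : Subalgebra ℂ (ProjSpace m → ℂ)} {h : ProjSpace m → SLGroup m}
    (hh : ∀ a b, (fun x => (h x).1 a b) ∈ R) (a b : Fin (n + 1)) :
    (fun x => (blockInclusion hk (h x)).1 a b) ∈ R :=
  R.add_mem (R.algebraMap_mem _) (mul_mem_chartAlgebra (fun _ _ => R.algebraMap_mem _)
    (mul_mem_chartAlgebra (fun a b => R.sub_mem (hh a b) (R.algebraMap_mem _))
      fun _ _ => R.algebraMap_mem _) a b)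

/-- Near every point of `ℙ^m` there is an algebraic family of symplectic matrices whose members
map the first standard line to the given line. -/
theorem exists_chart_formStabilizer {m : ℕ} {ω : LinearMap.BilinForm ℂ (Fin (m + 1) → ℂ)}
    (hω : ω.IsAlt) (hnd : ω.Nondegenerate) (p : ProjSpace m) :
    ∃ (ℓ : MvPolynomial (Fin (m + 1)) ℂ) (hℓ : ℓ.IsHomogeneous 1) (h : ProjSpace m → SLGroup m),
      MvPolynomial.eval p.rep ℓ ≠ 0 ∧ (∀ a b, (fun x => (h x).1 a b) ∈ chartAlgebra ℓ hℓ) ∧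
      ∀ x : ProjSpace m, MvPolynomial.eval x.rep ℓ ≠ 0 →
        h x ∈ formStabilizer ω ∧ slImage (h x) (stdSubspace m 1) = x.submodule := by
  obtain ⟨z, hz⟩ : ∃ z, ω p.rep z ≠ 0 := by
    by_contra! h
    exact p.rep_nonzero (hnd.1 _ h)
  have hz0 : z ≠ 0 := by
    rintro rfl
    exact hz (map_zero _)
  obtain ⟨g, hg, hgz⟩ := exists_mem_formStabilizer_toLin'_eq hω hnd
    (u := (Pi.single 0 1 : Fin (m + 1) → ℂ)) (by simp) hz0
  let ℓ : MvPolynomial (Fin (m + 1)) ℂ :=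
    ∑ c, MvPolynomial.C (ω (Pi.single c 1) z) * MvPolynomial.X c
  have hℓ : ℓ.IsHomogeneous 1 := MvPolynomial.IsHomogeneous.sum _ _ _ fun c _ => by
    simpa using (MvPolynomial.isHomogeneous_C _ _).mul (MvPolynomial.isHomogeneous_X ℂ c)
  have heval (v : Fin (m + 1) → ℂ) : MvPolynomial.eval v ℓ = ω v z := by
    conv_rhs => rw [pi_eq_sum_univ' v]
    simp only [ℓ, map_sum, map_mul, MvPolynomial.eval_C, MvPolynomial.eval_X,
      LinearMap.sum_apply, map_smul, LinearMap.smul_apply, smul_eq_mul]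
    refine Finset.sum_congr rfl fun c _ => ?_
    rw [mul_comm]
  -- `g` sends the first basis vector to `z`, and the transvection sends `z` to `x / ω(x, z)`. The
  -- coordinates of the latter are the degree-zero quotients `X a / ℓ`.
  refine ⟨ℓ, hℓ, fun x => formTransvection ω hω 1 ((ω x.rep z)⁻¹ • x.rep - z) * g,
    by rwa [heval], ?_, fun x hx => ⟨mul_mem (formTransvection_mem hω _ _) hg, ?_⟩⟩
  · refine mul_mem_chartAlgebra (formTransvection_mem_chartAlgebra hω 1 fun a => ?_)
      fun _ _ => (chartAlgebra ℓ hℓ).algebraMap_mem _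
    refine (chartAlgebra ℓ hℓ).sub_mem ⟨MvPolynomial.X a, 1, MvPolynomial.isHomogeneous_X ℂ a,
      fun x _ => ?_⟩ ((chartAlgebra ℓ hℓ).algebraMap_mem _)
    dsimp only
    rw [heval, MvPolynomial.eval_X, pow_one, Pi.smul_apply, smul_eq_mul, div_eq_inv_mul]
  · rw [heval] at hx
    rw [stdSubspace_one, slImage_span_singleton, toLin'_mul_apply, hgz,
      toLin'_formTransvection_sub hω, Projectivization.submodule_eq]
    · exact Submodule.span_singleton_smul_eq (isUnit_iff_ne_zero.2 (inv_ne_zero hx)) _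
    · rw [map_smul, LinearMap.smul_apply, smul_eq_mul, inv_mul_cancel₀ hx, one_mul]

/-! ### The morphism -/

theorem exists_ne_projSpace {m : ℕ} (hm : 0 < m) : ∃ x y : ProjSpace m, x ≠ y := by
  refine ⟨Projectivization.mk ℂ (Pi.single 0 1) (by simp),
    Projectivization.mk ℂ (Pi.single (Fin.last m) 1) (by simp), fun h => ?_⟩
  obtain ⟨c, hc⟩ := (Projectivization.mk_eq_mk_iff' _ _ _ _ _).1 h
  have h0 : (0 : Fin (m + 1)) ≠ Fin.last m := by
    simpa [Fin.ext_iff] using hm.ne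
  simpa [Pi.single_apply, h0] using congrFun hc 0

theorem theorem1p2 (n m i : ℕ) (hm : 1 < m) (hodd : Odd m) (hi : 1 < i)
    (hin : (i : ℤ) < (n : ℤ) - (m : ℤ) + 3) :
    ∃ f : ProjSpace m → FlagVariety n (indexSet n m i),
      IsVarietyMorphism (projVariety m) (flagVariety n (indexSet n m i)) f ∧
      (∃ x y, f x ≠ f y) ∧
      -- the map is `L ↦ (L ⊂ L^⊥)` inside a fibre of the projection forgetting
      -- the members of dimensions `i - 1` and `i + m - 2`
      ∃ (ω : LinearMap.BilinForm ℂ (Fin (m + 1) → ℂ))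
        (A : Submodule ℂ (Fin (n + 1) → ℂ))
        (ι : (Fin (m + 1) → ℂ) →ₗ[ℂ] (Fin (n + 1) → ℂ)),
        ω.IsAlt ∧ ω.Nondegenerate ∧ Function.Injective ι ∧
        Module.finrank ℂ A = i - 2 ∧ Disjoint A (LinearMap.range ι) ∧
        ∀ d : indexSet n m i,
          ((d : ℕ) = i - 1 → ∀ L, flagMember (f L) d = A ⊔ L.submodule.map ι) ∧
          ((d : ℕ) = i + m - 2 → ∀ L,
            flagMember (f L) d = A ⊔ (ω.orthogonal L.submodule).map ι) ∧
          ((d : ℕ) ≠ i - 1 → (d : ℕ) ≠ i + m - 2 → ∀ L L',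
            flagMember (f L) d = flagMember (f L') d) := by
  obtain ⟨k, rfl⟩ : ∃ k, i = k + 2 := ⟨i - 2, by omega⟩
  have hk : k + m ≤ n := by omega
  have hω := isAlt_antidiagMatrix hodd
  have hnd := nondegenerate_antidiagMatrix m
  set ω := (antidiagMatrix m).toBilin'
  have hex (L : ProjSpace m) :
      ∃ h ∈ formStabilizer ω, slImage h (stdSubspace m 1) = L.submodule := by
    obtain ⟨ℓ, hℓ, h, hL, -, hh⟩ := exists_chart_formStabilizer hω hnd L
    exact ⟨h L, hh L hL⟩
  -- An arbitrary pointwise choice: regularity is checked later on local lifts representing the same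
  -- cosets.
  choose s hs hsL using hex
  have hline (h : SLGroup m) : slImage (blockInclusion hk h) (stdSubspace n (k + 2 - 1)) =
      stdSubspace n k ⊔ (slImage h (stdSubspace m 1)).map (Matrix.toLin' (shiftMatrix n m k)) :=
    slImage_blockInclusion_add hk h (by omega)
  have horth (h : SLGroup m) (hh : h ∈ formStabilizer ω) :
      slImage (blockInclusion hk h) (stdSubspace n (k + 2 + m - 2)) = stdSubspace n k ⊔
        (ω.orthogonal (slImage h (stdSubspace m 1))).map
          (Matrix.toLin' (shiftMatrix n m k)) := by
    rw [show k + 2 + m - 2 = k + m by omega, slImage_blockInclusion_add hk h (by omega),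
      stdSubspace_eq_orthogonal hodd, slImage_orthogonal hh]
  have hother (h : SLGroup m) (d : ℕ) (hd : d ∈ indexSet n m (k + 2)) (h₁ : d ≠ k + 2 - 1)
      (h₂ : d ≠ k + 2 + m - 2) :
      slImage (blockInclusion hk h) (stdSubspace n d) = stdSubspace n d := by
    by_cases hdk : d ≤ k
    · exact slImage_blockInclusion_of_le hk h hdk
    -- The index set omits `k + 2, …, k + m - 1`, so only `d > k + m` remains.
    · have := hd.2
      rw [Set.mem_Icc] at this
      exact slImage_blockInclusion_of_lt hk h (by omega)
  let f (L : ProjSpace m) : FlagVariety n (indexSet n m (k + 2)) :=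
    QuotientGroup.mk (blockInclusion hk (s L))
  have hf₁ (d : indexSet n m (k + 2)) (hd : (d : ℕ) = k + 2 - 1) (L : ProjSpace m) :
      flagMember (f L) d =
        stdSubspace n k ⊔ L.submodule.map (Matrix.toLin' (shiftMatrix n m k)) := by
    change slImage _ (stdSubspace n d) = _
    rw [hd, hline, hsL]
  refine ⟨f, isVarietyMorphism_of_local_lift f fun p => ?_, ?_, ω, stdSubspace n k,
    Matrix.toLin' (shiftMatrix n m k), hω, hnd,
    Function.LeftInverse.injective (transpose_shiftMatrix_mulVec_shiftMatrix hk),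
    finrank_stdSubspace (by omega), disjoint_stdSubspace_range_shiftMatrix hk,
    fun d => ⟨hf₁ d, fun hd L => ?_, fun h₁ h₂ L L' => ?_⟩⟩
  · obtain ⟨ℓ, hℓ, h, hp, hreg, hh⟩ := exists_chart_formStabilizer hω hnd p
    refine ⟨ℓ, hℓ, fun x => blockInclusion hk (h x), hp,
      blockInclusion_mem_chartAlgebra hk hreg, fun x hx => mk_eq_mk_of_slImage_eq fun d hd => ?_⟩
    obtain ⟨hhω, hhx⟩ := hh x hx
    by_cases h₁ : d = k + 2 - 1
    · rw [h₁, hline, hline, hsL, hhx]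
    by_cases h₂ : d = k + 2 + m - 2
    · rw [h₂, horth _ (hs x), horth _ hhω, hsL, hhx]
    rw [hother _ d hd h₁ h₂, hother _ d hd h₁ h₂]
  · obtain ⟨x, y, hxy⟩ := exists_ne_projSpace (m := m) (by omega)
    refine ⟨x, y, fun h => hxy (Projectivization.submodule_injective ?_)⟩
    have hd : k + 2 - 1 ∈ indexSet n m (k + 2) := by
      simp only [indexSet, Set.mem_sdiff, Set.mem_Icc]
      omega
    rw [← map_transpose_shiftMatrix_sup hk x.submodule, ← hf₁ ⟨_, hd⟩ rfl x, h,
      hf₁ ⟨_, hd⟩ rfl y, map_transpose_shiftMatrix_sup hk]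
  · change slImage _ (stdSubspace n d) = _
    rw [hd, horth _ (hs L), hsL]
  · change slImage _ (stdSubspace n d) = slImage _ (stdSubspace n d)
    rw [hother _ d d.2 h₁ h₂, hother _ d d.2 h₁ h₂]
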